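/- Work in $\mathbb R^2$ with Cartesian coordinates $(x,y)$. For a scalar field $f$ and a vector field $\mathbf A=(A_x,A_y)$ put $$\operatorname{grad} f=(\partial_x f,\partial_y f),\quad \operatorname{Ham} f=(-\partial_y f,\partial_x f),\quad \operatorname{curl}_3\mathbf A=\partial_xA_y-\partial_yA_x,\quad \operatorname{div}\mathbf A=\partial_xA_x+\partial_yA_y,$$ $\mathbf A\cdot d\mathbf r=A_x\,dx+A_y\,dy$, $dS=dx\,dy$, and let $*$ be the Hodge star on 1-forms: linear over functions, $*dx=dy$, $*dy=-dx$. (1) Let $c$ be a piecewise $C^1$ path from $A$ to $B$ and let $f$ be a real function that is $C^1$ on an open set containing the image of $c$. Then the following integrals exist and $$\int_c \operatorname{grad} f\cdot d\mathbf r=f(B)-f(A),\qquad \int_c *(\operatorname{Ham} f\cdot d\mathbf r)=f(A)-f(B),$$ $$\text{(gradient theorem)}\qquad \int_c(\partial_xf)\,dx+(\partial_yf)\,dy=f(B)-f(A).$$ (2) Let $S\subset\mathbb R^2$ be compact, and let its topological boundary $\partial S$ be the union of finitely many pairwise disjoint simple closed curves, each piecewise $C^1$ and regular (the one-sided velocities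 on each piece do not vanish; corners and cusps between pieces are allowed), positively oriented: at each interior parameter at which the velocity exists, sufficiently short displacements from the curve along the left normal (the velocity rotated by $+\pi/2$) end in $S$, and along the right normal end outside $S$. Let $\mathbf A$ be a vector field, and $f,g$ real functions, that are $C^1$ on an open set containing $S$. Then the following integrals exist and $$\int_S(\operatorname{curl}_3\mathbf A)\,dS=\oint_{\partial S}\mathbf A\cdot d\mathbf r,\qquad \int_S(\operatorname{div}\mathbf A)\,dS=\oint_{\partial S}*(\mathbf A\cdot d\mathbf r),$$ $$\text{(Green's theorem)}\qquad \int_S(\partial_xg-\partial_yf)\,dx\,dy=\oint_{\partial S}f\,dx+g\,dy,$$ where $\oint_{\partial S}$ is the sum of the integrals over the boundary curves. (3) These four integral identities are only two different ones: for every $f$, $$\operatorname{grad} f\cdot d\mathbf r=\partial_xf\,dx+\partial_yf\,dy=-*(\operatorname{Ham} f\cdot d\mathbf r),$$ so both identities on $c$ are the gradient theorem; and for all $f,g$, $$\operatorname{curl}_3(f,g)=\operatorname{div}(g,-f)=\partial_xg-\partial_yf,\qquad (f,g)\cdot d\mathbf r=*\big((g,-f)\cdot d\mathbf r\big)=f\,dx+g\,dy,$$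 so the curl identity for $(f,g)$ and the divergence identity for $(g,-f)$ are both Green's theorem for $f\,dx+g\,dy$. -/

import Mathlib

noncomputable section

namespace PlaneCalculus

/-- The partial derivative of `f` with respect to the first Cartesian coordinate. -/
def partialX (f : ℝ × ℝ → ℝ) (p : ℝ × ℝ) : ℝ := deriv (fun x : ℝ => f (x, p.2)) p.1

/-- The partial derivative of `f` with respect to the second Cartesian coordinate. -/
def partialY (f : ℝ × ℝ → ℝ) (p : ℝ × ℝ) : ℝ := deriv (fun y : ℝ => f (p.1, y)) p.2

/-- `grad f = (∂ₓ f, ∂_y f)`. -/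
def grad (f : ℝ × ℝ → ℝ) (p : ℝ × ℝ) : ℝ × ℝ := (partialX f p, partialY f p)

/-- The Hamiltonian field `Ham f = (-∂_y f, ∂ₓ f)`. -/
def ham (f : ℝ × ℝ → ℝ) (p : ℝ × ℝ) : ℝ × ℝ := (-partialY f p, partialX f p)

/-- `curl₃ A = ∂ₓ A_y - ∂_y A_x`. -/
def curl3 (A : ℝ × ℝ → ℝ × ℝ) (p : ℝ × ℝ) : ℝ :=
  partialX (fun q => (A q).2) p - partialY (fun q => (A q).1) p

/-- `div A = ∂ₓ A_x + ∂_y A_y`. -/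
def div (A : ℝ × ℝ → ℝ × ℝ) (p : ℝ × ℝ) : ℝ :=
  partialX (fun q => (A q).1) p + partialY (fun q => (A q).2) p

/-- The covector `dx`. -/
def dx : ℝ × ℝ →L[ℝ] ℝ := ContinuousLinearMap.fst ℝ ℝ ℝ

/-- The covector `dy`. -/
def dy : ℝ × ℝ →L[ℝ] ℝ := ContinuousLinearMap.snd ℝ ℝ ℝ

/-- The 1-form `f dx + g dy`. -/
def oneForm (f g : ℝ × ℝ → ℝ) (p : ℝ × ℝ) : ℝ × ℝ →L[ℝ] ℝ := f p • dx + g p • dy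

/-- The 1-form `A · dr = A_x dx + A_y dy`. -/
def dotDr (A : ℝ × ℝ → ℝ × ℝ) : ℝ × ℝ → (ℝ × ℝ →L[ℝ] ℝ) :=
  oneForm (fun p => (A p).1) (fun p => (A p).2)

/-- The Hodge star on 1-forms of the Euclidean plane oriented by `dx ∧ dy`: it is linear over
functions, and `* dx = dy`, `* dy = -dx`. Here `α p (1, 0)` and `α p (0, 1)` are the coefficients
of `dx` and `dy` in `α`. -/
def hodge (α : ℝ × ℝ → (ℝ × ℝ →L[ℝ] ℝ)) (p : ℝ × ℝ) : ℝ × ℝ →L[ℝ] ℝ :=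
  α p (1, 0) • dy - α p (0, 1) • dx

/-- Rotation of a vector by `π / 2` in the positive (counter-clockwise) sense. -/
def rot (v : ℝ × ℝ) : ℝ × ℝ := (-v.2, v.1)

/-- A path in the plane is piecewise `C¹` if `[0, 1]` has a finite partition such that the path
is `C¹` (one-sidedly at the end points) on each closed subinterval. -/
def IsPiecewiseC1 {a b : ℝ × ℝ} (γ : Path a b) : Prop :=
  ∃ (n : ℕ) (t : Fin (n + 1) → ℝ), StrictMono t ∧ t 0 = 0 ∧ t (Fin.last n) = 1 ∧
    ∀ i : Fin n, ContDiffOn ℝ 1 γ.extend (Set.Icc (t i.castSucc) (t i.succ))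

/-- A path in the plane is piecewise `C¹` and regular if `[0, 1]` has a finite partition such that
on each closed subinterval the path is `C¹` with nowhere vanishing velocity (one-sided at the end
points). Corners and cusps are allowed at the partition points. -/
def IsPiecewiseRegularC1 {a b : ℝ × ℝ} (γ : Path a b) : Prop :=
  ∃ (n : ℕ) (t : Fin (n + 1) → ℝ), StrictMono t ∧ t 0 = 0 ∧ t (Fin.last n) = 1 ∧
    ∀ i : Fin n, ContDiffOn ℝ 1 γ.extend (Set.Icc (t i.castSucc) (t i.succ)) ∧
      ∀ s ∈ Set.Icc (t i.castSucc) (t i.succ),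
        derivWithin γ.extend (Set.Icc (t i.castSucc) (t i.succ)) s ≠ 0

/-- The closed paths `γ i` together form the positively oriented boundary of the plane set `S`:
they are pairwise disjoint simple closed piecewise `C¹` regular curves, their union is the
topological boundary of `S`, and, wherever a velocity exists, `S` lies to the left of the curve
and the complement of `S` lies to its right. -/
structure IsOrientedBoundary (S : Set (ℝ × ℝ)) {m : ℕ} {P : Fin m → ℝ × ℝ}
    (γ : ∀ i, Path (P i) (P i)) : Prop where
  piecewise_regular : ∀ i, IsPiecewiseRegularC1 (γ i)
  simple : ∀ i, Set.InjOn (γ i).extend (Set.Ico 0 1)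
  disjoint : ∀ i j, i ≠ j → Disjoint (Set.range (γ i)) (Set.range (γ j))
  frontier_eq : frontier S = ⋃ i, Set.range (γ i)
  left : ∀ i, ∀ t ∈ Set.Ioo (0 : ℝ) 1, DifferentiableAt ℝ (γ i).extend t →
    ∀ᶠ s in nhdsWithin (0 : ℝ) (Set.Ioi 0),
      (γ i).extend t + s • rot (deriv (γ i).extend t) ∈ S ∧
      (γ i).extend t - s • rot (deriv (γ i).extend t) ∉ S

/-- The integral of a 1-form over the boundary that consists of the closed curves `γ i`. -/
def boundaryIntegral (α : ℝ × ℝ → (ℝ × ℝ →L[ℝ] ℝ)) {m : ℕ} {P : Fin m → ℝ × ℝ}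
    (γ : ∀ i, Path (P i) (P i)) : ℝ :=
  ∑ i, curveIntegral α (γ i)

end PlaneCalculus

end

namespace PlaneCalculus

open Set MeasureTheory Filter Topology
open scoped NNReal

/-! ### One-forms and partial derivatives -/

/-! The gradient theorem is the fundamental theorem of calculus for `f ∘ c`, which is differentiable
off finitely many parameters. The other identities on paths and regions reduce to coordinate forms
by algebra on 1-forms. Green's theorem is proved without cutting `S` into simple regions. Take the
term `f dx`, with `f` cut off to have compact support. By a one-dimensional Sard argument, almost
every vertical line meets the boundary only where the velocity exists and is not vertical, hence in
finitely many points. On such a line the characteristic function of `S` jumps exactly at these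
points, and the orientation says that each jump is the sign of the horizontal velocity
(`eventually_vertical`, `indicator_slice`). Integrating `∂_y f` over the slice therefore gives the
sum of `sign(x') * (-f)` over the crossings. Fubini leaves an integral over `x` of sums over fibres
of the functions `t ↦ x(t)`. The area formula `integral_sum_fibers` turns it into an integral over
`t` with weight `|x'|`, and `|x'| sign(x') = x'` yields `-∮ f dx`. A quarter turn gives the term `g
dy`. -/

theorem oneForm_apply (f g : ℝ × ℝ → ℝ) (p v : ℝ × ℝ) :
    oneForm f g p v = f p * v.1 + g p * v.2 := by
  simp [oneForm, dx, dy]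

theorem hodge_dotDr (A : ℝ × ℝ → ℝ × ℝ) :
    hodge (dotDr A) = oneForm (fun p => -(A p).2) (fun p => (A p).1) := by
  funext p
  ext <;> simp [hodge, dotDr, oneForm, dx, dy]

theorem hodge_dotDr_ham (f : ℝ × ℝ → ℝ) :
    hodge (dotDr (ham f)) = -oneForm (partialX f) (partialY f) := by
  rw [hodge_dotDr]
  funext p
  ext <;> simp [ham, oneForm, dx, dy]

/-- Differentiability is not needed: `deriv` commutes with negation even at its default value. -/
theorem div_neg_right (f g : ℝ × ℝ → ℝ) :
    div (fun p => (g p, -f p)) = fun p => partialX g p - partialY f p := by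
  funext p
  simp [div, partialX, partialY, deriv.fun_neg, sub_eq_add_neg]

theorem partialX_eq_fderiv {f : ℝ × ℝ → ℝ} {p : ℝ × ℝ} (hf : DifferentiableAt ℝ f p) :
    partialX f p = fderiv ℝ f p (1, 0) := by
  have h : HasDerivAt (fun x : ℝ => (x, p.2)) (1, 0) p.1 :=
    (hasDerivAt_id _).prodMk (hasDerivAt_const _ _)
  exact (hf.hasFDerivAt.comp_hasDerivAt (f := fun x : ℝ => (x, p.2)) p.1 h).deriv

theorem partialY_eq_fderiv {f : ℝ × ℝ → ℝ} {p : ℝ × ℝ} (hf : DifferentiableAt ℝ f p) :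
    partialY f p = fderiv ℝ f p (0, 1) := by
  have h : HasDerivAt (fun y : ℝ => (p.1, y)) (0, 1) p.2 :=
    (hasDerivAt_const _ _).prodMk (hasDerivAt_id _)
  exact (hf.hasFDerivAt.comp_hasDerivAt (f := fun y : ℝ => (p.1, y)) p.2 h).deriv

theorem oneForm_partial_eq_fderiv {f : ℝ × ℝ → ℝ} {p : ℝ × ℝ} (hf : DifferentiableAt ℝ f p) :
    oneForm (partialX f) (partialY f) p = fderiv ℝ f p := by
  ext
  · simp [oneForm_apply, partialX_eq_fderiv hf]
  · simp [oneForm_apply, partialY_eq_fderiv hf]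

theorem continuousOn_partialX {f : ℝ × ℝ → ℝ} {U : Set (ℝ × ℝ)} (hU : IsOpen U)
    (hf : ContDiffOn ℝ 1 f U) : ContinuousOn (partialX f) U :=
  ((hf.continuousOn_fderiv_of_isOpen hU le_rfl).clm_apply continuousOn_const).congr fun _ hp =>
    partialX_eq_fderiv ((hf.differentiableOn one_ne_zero).differentiableAt (hU.mem_nhds hp))

theorem continuousOn_partialY {f : ℝ × ℝ → ℝ} {U : Set (ℝ × ℝ)} (hU : IsOpen U)
    (hf : ContDiffOn ℝ 1 f U) : ContinuousOn (partialY f) U :=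
  ((hf.continuousOn_fderiv_of_isOpen hU le_rfl).clm_apply continuousOn_const).congr fun _ hp =>
    partialY_eq_fderiv ((hf.differentiableOn one_ne_zero).differentiableAt (hU.mem_nhds hp))

/-! ### Piecewise `C¹` paths -/

theorem IsPiecewiseRegularC1.isPiecewiseC1 {a b : ℝ × ℝ} {γ : Path a b}
    (h : IsPiecewiseRegularC1 γ) : IsPiecewiseC1 γ := by
  obtain ⟨n, t, ht, h0, h1, H⟩ := h
  exact ⟨n, t, ht, h0, h1, fun i => (H i).1⟩

theorem IsPiecewiseC1.exists_finite_differentiableAt {a b : ℝ × ℝ} {γ : Path a b}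
    (h : IsPiecewiseC1 γ) :
    ∃ B : Set ℝ, B.Finite ∧ ∀ s ∈ Ioo (0 : ℝ) 1, s ∉ B → DifferentiableAt ℝ γ.extend s := by
  obtain ⟨n, t, -, h0, h1, H⟩ := h
  refine ⟨range t, finite_range t, ?_⟩
  have key : ∀ i : Fin (n + 1), ∀ s ∈ Ioo 0 (t i), s ∉ range t →
      DifferentiableAt ℝ γ.extend s := by
    intro i
    induction i using Fin.induction with
    | zero => intro s hs; rw [h0] at hs; exact absurd hs.2 hs.1.not_gt
    | succ i ih =>
      intro s hs hst
      rcases lt_trichotomy s (t i.castSucc) with h | h | h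
      · exact ih s ⟨hs.1, h⟩ hst
      · exact absurd ⟨_, h.symm⟩ hst
      · exact ((H i).differentiableOn one_ne_zero).differentiableAt (Icc_mem_nhds h hs.2)
  simpa only [h1] using key (Fin.last n)

/-- On each closed piece the one-sided derivative is continuous, and it differs from `deriv` at most
at the two end points, a null set. -/
theorem IsPiecewiseC1.intervalIntegrable {a b : ℝ × ℝ} {γ : Path a b} (h : IsPiecewiseC1 γ)
    {α : ℝ → (ℝ × ℝ →L[ℝ] ℝ)} (hα : ContinuousOn α (Icc 0 1)) :
    IntervalIntegrable (fun s => α s (deriv γ.extend s)) volume 0 1 := by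
  obtain ⟨n, t, ht, h0, h1, H⟩ := h
  have key : ∀ i : Fin (n + 1),
      IntervalIntegrable (fun s => α s (deriv γ.extend s)) volume 0 (t i) := by
    intro i
    induction i using Fin.induction with
    | zero => rw [h0]
    | succ i ih =>
      refine ih.trans ?_
      have hlt : t i.castSucc < t i.succ := ht i.castSucc_lt_succ
      have hsub : Icc (t i.castSucc) (t i.succ) ⊆ Icc 0 1 :=
        Icc_subset_Icc (h0 ▸ ht.monotone (Fin.zero_le _)) (h1 ▸ ht.monotone (Fin.le_last _))
      have hc : ContinuousOn
          (fun s => α s (derivWithin γ.extend (Icc (t i.castSucc) (t i.succ)) s))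
          (Icc (t i.castSucc) (t i.succ)) :=
        (hα.mono hsub).clm_apply
          ((H i).continuousOn_derivWithin (uniqueDiffOn_Icc hlt) le_rfl)
      refine (hc.intervalIntegrable_of_Icc hlt.le).congr_ae ?_
      rw [uIoc_of_le hlt.le, ← restrict_Ioo_eq_restrict_Ioc]
      filter_upwards [ae_restrict_mem measurableSet_Ioo] with s hs
      rw [derivWithin_of_mem_nhds (Icc_mem_nhds hs.1 hs.2)]
  simpa only [h1] using key (Fin.last n)

theorem curveIntegrable_iff {a b : ℝ × ℝ} {γ : Path a b} {α : ℝ × ℝ → (ℝ × ℝ →L[ℝ] ℝ)} :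
    CurveIntegrable α γ ↔
      IntervalIntegrable (fun s => α (γ.extend s) (deriv γ.extend s)) volume 0 1 := by
  refine intervalIntegrable_congr_ae ?_
  rw [uIoc_of_le zero_le_one, ← restrict_Ioo_eq_restrict_Ioc]
  filter_upwards [ae_restrict_mem measurableSet_Ioo] with s hs
  rw [curveIntegralFun_def, derivWithin_of_mem_nhds (Icc_mem_nhds hs.1 hs.2)]

theorem extend_mem_range {a b : ℝ × ℝ} (γ : Path a b) (s : ℝ) : γ.extend s ∈ range γ := by
  rw [← γ.extend_range]; exact mem_range_self s

theorem IsPiecewiseC1.curveIntegrable {a b : ℝ × ℝ} {γ : Path a b} (h : IsPiecewiseC1 γ)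
    {α : ℝ × ℝ → (ℝ × ℝ →L[ℝ] ℝ)} (hα : ContinuousOn α (range γ)) : CurveIntegrable α γ :=
  curveIntegrable_iff.2 <| h.intervalIntegrable <|
    hα.comp γ.continuous_extend.continuousOn fun s _ => extend_mem_range γ s

theorem continuousOn_oneForm {f g : ℝ × ℝ → ℝ} {s : Set (ℝ × ℝ)} (hf : ContinuousOn f s)
    (hg : ContinuousOn g s) : ContinuousOn (oneForm f g) s :=
  (hf.smul continuousOn_const).add (hg.smul continuousOn_const)

/-- The gradient theorem. -/
theorem gradient_theorem {A B : ℝ × ℝ} {c : Path A B} (hc : IsPiecewiseC1 c)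
    {U : Set (ℝ × ℝ)} (hU : IsOpen U) (hcU : range c ⊆ U) {f : ℝ × ℝ → ℝ}
    (hf : ContDiffOn ℝ 1 f U) :
    CurveIntegrable (oneForm (partialX f) (partialY f)) c ∧
      curveIntegral (oneForm (partialX f) (partialY f)) c = f B - f A := by
  have hint : CurveIntegrable (oneForm (partialX f) (partialY f)) c :=
    hc.curveIntegrable ((continuousOn_oneForm (continuousOn_partialX hU hf)
      (continuousOn_partialY hU hf)).mono hcU)
  refine ⟨hint, ?_⟩
  obtain ⟨F, hF, hd⟩ := hc.exists_finite_differentiableAt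
  have hmem : ∀ s, c.extend s ∈ U := fun s => hcU (extend_mem_range c s)
  -- This form of the fundamental theorem allows a countable exceptional set, so the path need not
  -- be split at its corners.
  rw [curveIntegral_eq_intervalIntegral_deriv,
    integral_eq_of_hasDerivAt_off_countable (f ∘ c.extend) _ hF.countable
      (hf.continuousOn.comp c.continuous_extend.continuousOn fun s _ => hmem s) ?_
      (curveIntegrable_iff.1 hint)]
  · simp
  · intro s hs
    have hfs : DifferentiableAt ℝ f (c.extend s) :=
      (hf.differentiableOn one_ne_zero).differentiableAt (hU.mem_nhds (hmem s))
    rw [oneForm_partial_eq_fderiv hfs]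
    refine hfs.hasFDerivAt.comp_hasDerivAt s (hd s ?_ hs.2).hasDerivAt
    simpa using hs.1

/-! ### The one-dimensional area formula with multiplicity -/

/-- A set on which a function has nonzero derivative is a countable disjoint union of
measurable sets on which the function is injective. -/
theorem exists_partition_injOn {u u' : ℝ → ℝ} {W : Set ℝ} (hW : MeasurableSet W)
    (hu : ∀ t ∈ W, HasDerivWithinAt u (u' t) W t) (hu0 : ∀ t ∈ W, u' t ≠ 0) :
    ∃ M : ℕ → Set ℝ, Pairwise (Function.onFun Disjoint M) ∧ (∀ n, MeasurableSet (M n)) ∧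
      (⋃ n, M n) = W ∧ ∀ n, InjOn u (M n) := by
  classical
  rcases W.eq_empty_or_nonempty with rfl | hne
  · exact ⟨fun _ => ∅, fun _ _ _ => disjoint_empty _, fun _ => .empty, by simp, by simp⟩
  -- A linear map of slope `A 1` stretches distances by `‖A 1‖`, so an approximation error of half
  -- that rate still forces injectivity. The value `1` only keeps `r` nonzero; the maps that occur
  -- are derivatives at points of `W` and have nonzero slope.
  let r : (ℝ →L[ℝ] ℝ) → ℝ≥0 := fun A => if A 1 = 0 then 1 else ‖A 1‖₊ / 2
  have hr : ∀ A, r A ≠ 0 := by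
    intro A
    by_cases h : A 1 = 0 <;> simp [r, h]
  obtain ⟨t, A, hdisj, hmeas, hcov, happ, hA⟩ :=
    exists_partition_approximatesLinearOn_of_hasFDerivWithinAt u W _
      (fun x hx => (hu x hx).hasFDerivWithinAt) r hr
  refine ⟨fun n => W ∩ t n, fun i j hij => (hdisj hij).mono inter_subset_right inter_subset_right,
    fun n => hW.inter (hmeas n), by rw [← inter_iUnion, inter_eq_left.2 hcov], fun n => ?_⟩
  intro x hx y hy hxy
  obtain ⟨z, hz, hAz⟩ := hA hne n
  have hA1 : A n 1 ≠ 0 := by simpa [hAz] using hu0 z hz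
  have h := happ n x hx y hy
  have e : A n (x - y) = (x - y) * A n 1 := by
    rw [← smul_eq_mul, ← map_smul, smul_eq_mul, mul_one]
  simp only [hxy, sub_self, zero_sub, norm_neg, e, r, hA1, if_false, norm_mul] at h
  push_cast at h
  have hpos : 0 < ‖A n 1‖ := norm_pos_iff.2 hA1
  have : ‖x - y‖ * ‖A n 1‖ ≤ 0 := by linarith
  have h0 : ‖x - y‖ = 0 := le_antisymm (nonpos_of_mul_nonpos_left this hpos) (norm_nonneg _)
  exact sub_eq_zero.1 (norm_eq_zero.1 h0)

/-- Sum of `G` over the points of `M` in the fibre of `u` over `x`. -/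
noncomputable def fiberSum (u G : ℝ → ℝ) (M : Set ℝ) (x : ℝ) : ℝ := ∑' t, (M ∩ u ⁻¹' {x}).indicator G t

theorem fiberSum_apply {u G : ℝ → ℝ} {M : Set ℝ} (h : InjOn u M) {t : ℝ} (ht : t ∈ M) :
    fiberSum u G M (u t) = G t := by
  rw [fiberSum, tsum_eq_single t, indicator_of_mem (show t ∈ M ∩ u ⁻¹' {u t} from ⟨ht, rfl⟩)]
  intro s hs
  exact indicator_of_notMem (fun hm => hs (h hm.1 ht hm.2)) _

theorem fiberSum_of_notMem_image {u G : ℝ → ℝ} {M : Set ℝ} {x : ℝ} (hx : x ∉ u '' M) :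
    fiberSum u G M x = 0 := by
  have : M ∩ u ⁻¹' {x} = ∅ := by
    ext t; simp only [mem_inter_iff, mem_preimage, mem_singleton_iff, mem_empty_iff_false, iff_false]
    exact fun h => hx ⟨t, h⟩
  simp [fiberSum, this]

theorem fiberSum_eq_sum {u G : ℝ → ℝ} {M : Set ℝ} {x : ℝ} {T : Finset ℝ}
    (hT : ∀ t ∈ M, u t = x → t ∈ T) : fiberSum u G M x =
      ∑ t ∈ T, (M ∩ u ⁻¹' {x}).indicator G t :=
  tsum_eq_sum fun t ht => indicator_of_notMem (fun h => ht (hT t h.1 h.2)) _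

section injective
variable {u u' G : ℝ → ℝ} {M : Set ℝ}

theorem image_indicator_fiberSum : (u '' M).indicator (fiberSum u G M) = fiberSum u G M := by
  refine indicator_eq_self.2 fun x hx => ?_
  by_contra h
  exact hx (fiberSum_of_notMem_image h)

theorem measurableSet_image_of_injOn (hM : MeasurableSet M)
    (hu : ∀ t ∈ M, HasDerivWithinAt u (u' t) M t) (hinj : InjOn u M) : MeasurableSet (u '' M) :=
  hM.image_of_continuousOn_injOn (fun t ht => (hu t ht).continuousWithinAt) hinj

/-- On an injective piece the fibre sum has at most one nonzero term, so this is the change of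
variables formula on `u '' M`. -/
theorem integrable_fiberSum (hM : MeasurableSet M)
    (hu : ∀ t ∈ M, HasDerivWithinAt u (u' t) M t) (hinj : InjOn u M)
    (hG : IntegrableOn (fun t => |u' t| * G t) M) : Integrable (fiberSum u G M) := by
  rw [← image_indicator_fiberSum, integrable_indicator_iff
    (measurableSet_image_of_injOn hM hu hinj),
    integrableOn_image_iff_integrableOn_abs_deriv_smul hM hu hinj]
  refine hG.congr_fun (fun t ht => ?_) hM
  simp only [fiberSum_apply hinj ht, smul_eq_mul]

theorem integral_fiberSum (hM : MeasurableSet M)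
    (hu : ∀ t ∈ M, HasDerivWithinAt u (u' t) M t) (hinj : InjOn u M) :
    ∫ x, fiberSum u G M x = ∫ t in M, |u' t| * G t := by
  rw [← image_indicator_fiberSum, integral_indicator (measurableSet_image_of_injOn hM hu hinj),
    integral_image_eq_integral_abs_deriv_smul hM hu hinj]
  exact setIntegral_congr_fun hM fun t ht => by simp only [fiberSum_apply hinj ht, smul_eq_mul]

theorem integral_norm_fiberSum (hM : MeasurableSet M)
    (hu : ∀ t ∈ M, HasDerivWithinAt u (u' t) M t) (hinj : InjOn u M) :
    ∫ x, ‖fiberSum u G M x‖ = ∫ t in M, ‖|u' t| * G t‖ := by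
  rw [← image_indicator_fiberSum]
  simp_rw [norm_indicator_eq_indicator_norm]
  rw [integral_indicator (measurableSet_image_of_injOn hM hu hinj),
    integral_image_eq_integral_abs_deriv_smul hM hu hinj]
  exact setIntegral_congr_fun hM fun t ht => by
    simp only [fiberSum_apply hinj ht, smul_eq_mul, norm_mul, Real.norm_eq_abs, abs_abs]

end injective

/-- The area formula for finitely many functions `u i` of one variable, with `T i x` the fibre of
`u i` over `x`. -/
theorem integral_sum_fibers {ι : Type*} [Fintype ι] {u u' G : ι → ℝ → ℝ} {W : ι → Set ℝ}
    (hW : ∀ i, MeasurableSet (W i))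
    (hu : ∀ i, ∀ t ∈ W i, HasDerivWithinAt (u i) (u' i t) (W i) t)
    (hu0 : ∀ i, ∀ t ∈ W i, u' i t ≠ 0)
    (hG : ∀ i, IntegrableOn (fun t => |u' i t| * G i t) (W i)) {T : ι → ℝ → Finset ℝ}
    (hT : ∀ᵐ x, ∀ i t, t ∈ T i x ↔ t ∈ W i ∧ u i t = x) :
    ∫ x, ∑ i, ∑ t ∈ T i x, G i t = ∑ i, ∫ t in W i, |u' i t| * G i t := by
  choose M hdisj hmeas hcov hinj using fun i => exists_partition_injOn (hW i) (hu i) (hu0 i)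
  have hsub : ∀ i k, M i k ⊆ W i := fun i k => hcov i ▸ subset_iUnion (M i) k
  have hder : ∀ i k, ∀ t ∈ M i k, HasDerivWithinAt (u i) (u' i t) (M i k) t :=
    fun i k t ht => (hu i t (hsub i k ht)).mono (hsub i k)
  have hGM : ∀ i, IntegrableOn (fun t => |u' i t| * G i t) (⋃ k, M i k) :=
    fun i => (hcov i).symm ▸ hG i
  let F : ι × ℕ → ℝ → ℝ := fun q => fiberSum (u q.1) (G q.1) (M q.1 q.2)
  have hF : ∀ q, Integrable (F q) := fun q =>
    integrable_fiberSum (hmeas _ _) (hder _ _) (hinj _ _) ((hG q.1).mono_set (hsub _ _))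
  -- For fixed `i` the norms add up to the integral of `‖|u'| * G‖` over `W i`; this justifies
  -- interchanging sum and integral.
  have hFn : Summable fun q => ∫ x, ‖F q x‖ := by
    rw [summable_prod_of_nonneg fun q => integral_nonneg fun x => norm_nonneg _]
    refine ⟨fun i => ?_, Summable.of_finite⟩
    simp only [F, integral_norm_fiberSum (hmeas _ _) (hder _ _) (hinj _ _)]
    exact (hasSum_integral_iUnion (hmeas i) (hdisj i) (hGM i).norm).summable
  have hsum := hasSum_integral_of_summable_integral_norm hF hFn
  have hval : ∑' q, ∫ x, F q x = ∑ i, ∫ t in W i, |u' i t| * G i t := by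
    rw [hsum.summable.tsum_prod, tsum_fintype]
    refine Finset.sum_congr rfl fun i _ => ?_
    simp only [F, integral_fiberSum (hmeas _ _) (hder _ _) (hinj _ _)]
    rw [← integral_iUnion (hmeas i) (hdisj i) (hGM i), hcov]
  rw [← hval, hsum.tsum_eq]
  refine integral_congr_ae ?_
  filter_upwards [hT] with x hx
  have hFx : ∀ i k, F (i, k) x = ∑ t ∈ T i x, (M i k).indicator (G i) t := by
    intro i k
    refine (fiberSum_eq_sum (T := T i x) fun t ht h => (hx i t).2 ⟨hsub i k ht, h⟩).trans ?_
    refine Finset.sum_congr rfl fun t ht => ?_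
    by_cases h : t ∈ M i k
    · rw [indicator_of_mem h, indicator_of_mem (show t ∈ M i k ∩ u i ⁻¹' {x} from ⟨h, ((hx i t).1 ht).2⟩)]
    · rw [indicator_of_notMem h, indicator_of_notMem fun h' => h h'.1]
  -- Each point of the fibre lies in exactly one piece, so the sum over pieces has one nonzero term.
  have hind : ∀ i, ∀ t ∈ T i x, HasSum (fun k => (M i k).indicator (G i) t) (G i t) := by
    intro i t ht
    obtain ⟨k, hk⟩ := mem_iUnion.1 ((hcov i).symm ▸ ((hx i t).1 ht).1 : t ∈ ⋃ k, M i k)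
    have := hasSum_single (f := fun k => (M i k).indicator (G i) t) k fun l hl =>
      indicator_of_notMem (fun h => (hdisj i hl).le_bot ⟨h, hk⟩) _
    rwa [indicator_of_mem hk] at this
  have hs : ∀ i, HasSum (fun k => F (i, k) x) (∑ t ∈ T i x, G i t) := by
    intro i
    simp only [hFx]
    exact hasSum_sum (hind i)
  have hsummable : Summable fun q => F q x := by
    rw [← summable_abs_iff, summable_prod_of_nonneg fun q => abs_nonneg _]
    exact ⟨fun i => (hs i).summable.abs, Summable.of_finite⟩
  rw [hsummable.tsum_prod, tsum_fintype]
  exact Finset.sum_congr rfl fun i _ => (hs i).tsum_eq.symm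

/-! ### Sides of the boundary -/

/-- Off the frontier, the space is the disjoint union of the open sets `interior s` and `(closure
s)ᶜ`, and a preconnected set cannot meet both. -/
theorem subset_of_isPreconnected_of_disjoint_frontier {X : Type*} [TopologicalSpace X]
    {s t : Set X} (ht : IsPreconnected t) (hd : Disjoint t (frontier s))
    (hne : (t ∩ s).Nonempty) : t ⊆ s := by
  have hsub : t ⊆ interior s ∪ (closure s)ᶜ := by
    intro x hx
    by_contra h
    simp only [mem_union, mem_compl_iff, not_or, not_not] at h
    exact hd.le_bot ⟨hx, h.2, h.1⟩
  obtain ⟨x, hxt, hxs⟩ := hne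
  refine (ht.subset_left_of_subset_union isOpen_interior isClosed_closure.isOpen_compl ?_ hsub
    ⟨x, hxt, ?_⟩).trans interior_subset
  · exact disjoint_compl_right.mono_left (interior_subset.trans subset_closure)
  · exact (hsub hxt).resolve_right fun h => h (subset_closure hxs)

/-- Points of a differentiable curve near a point with nonzero velocity lie in a narrow cone
about the tangent line. -/
theorem eventually_mem_cone {γ : ℝ → ℝ × ℝ} {t : ℝ} {v : ℝ × ℝ} (h : HasDerivAt γ v t)
    (hv : v ≠ 0) {ε : ℝ} (hε : 0 < ε) :
    ∀ᶠ s in 𝓝 t, |-v.2 * ((γ s).1 - (γ t).1) + v.1 * ((γ s).2 - (γ t).2)| ≤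
      ε * ‖γ s - γ t‖ := by
  -- The functional `n` pairs with the normal and kills `v`, so it sees only the `o(s - t)`
  -- remainder; as `v ≠ 0`, `s - t` is itself `O(γ s - γ t)`.
  let n : ℝ × ℝ →L[ℝ] ℝ := -v.2 • dx + v.1 • dy
  have hn : ∀ p, n p = -v.2 * p.1 + v.1 * p.2 := fun p => by simp [n, dx, dy]
  have h1 : (fun s => γ s - γ t - (s - t) • v) =o[𝓝 t] fun s => s - t := h.isLittleO
  have h2 : (fun s => n (γ s - γ t)) =o[𝓝 t] fun s => s - t := by
    refine ((n.isBigO_comp _ _).trans_isLittleO h1).congr_left fun s => ?_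
    rw [map_sub n (γ s - γ t), map_smul, hn v]
    simp only [smul_eq_mul]; ring
  have h3 : (fun s => s - t) =O[𝓝 t] fun s => γ s - γ t := by
    have hto : Tendsto (fun s : ℝ => (s, t)) (𝓝 t) (𝓝 t ×ˢ pure t) :=
      tendsto_id.prodMk (tendsto_pure.2 (Eventually.of_forall fun _ => rfl))
    exact (h.isTheta_sub hv).isBigO_symm.comp_tendsto hto
  filter_upwards [(h2.trans_isBigO h3).bound hε] with s hs
  simpa [hn] using hs

variable {S : Set (ℝ × ℝ)} {m : ℕ} {P : Fin m → ℝ × ℝ} {γ : ∀ i, Path (P i) (P i)}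

/-- A boundary point determines its curve and its parameter, if this parameter is interior. -/
theorem IsOrientedBoundary.eq_of_extend_eq (h : IsOrientedBoundary S γ) {i j : Fin m}
    {s t : ℝ} (ht : t ∈ Ioo (0 : ℝ) 1) (hs : s ∈ Icc (0 : ℝ) 1)
    (he : (γ j).extend s = (γ i).extend t) : j = i ∧ s = t := by
  have hji : j = i := by
    by_contra hne
    refine (h.disjoint j i hne).le_bot ⟨extend_mem_range (γ j) s, ?_⟩
    rw [he]; exact extend_mem_range (γ i) t
  subst hji
  refine ⟨rfl, ?_⟩
  -- Injectivity is assumed only on `[0, 1)`; the parameter `1` gives the same point as `0`, which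
  -- differs from `t > 0`.
  rcases hs.2.lt_or_eq with hs1 | rfl
  · exact h.simple j ⟨hs.1, hs1⟩ ⟨ht.1.le, ht.2⟩ he
  · have h0 : (γ j).extend 0 = (γ j).extend t := by rw [← he]; simp
    exact absurd (h.simple j ⟨le_rfl, one_pos⟩ ⟨ht.1.le, ht.2⟩ h0) ht.1.ne

theorem range_eq_image_extend {a b : ℝ × ℝ} (γ : Path a b) :
    range γ = γ.extend '' Icc 0 1 :=
  (γ.image_extend_of_subset subset_rfl).symm

/-- Near `γ i t`, the frontier consists of points of `γ i` with parameters near `t`. -/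
theorem IsOrientedBoundary.eventually_frontier (h : IsOrientedBoundary S γ) {i : Fin m} {t : ℝ}
    (ht : t ∈ Ioo (0 : ℝ) 1) {p : ℝ × ℝ → Prop}
    (hp : ∀ᶠ s in 𝓝 t, p ((γ i).extend s)) :
    ∀ᶠ q in 𝓝 ((γ i).extend t), q ∈ frontier S → p q := by
  obtain ⟨V, hVp, hVo, htV⟩ := eventually_nhds_iff.1 hp
  -- These compact sets make up the boundary without the arc with parameters in `V`. None contains
  -- `γ i t`, so a neighbourhood of that point avoids them all.
  have hK : ∀ j, IsClosed ((γ j).extend '' {s | s ∈ Icc (0 : ℝ) 1 ∧ ¬ (j = i ∧ s ∈ V)}) := by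
    intro j
    refine (IsCompact.image (isCompact_Icc.of_isClosed_subset ?_ fun s hs => hs.1)
      (γ j).continuous_extend).isClosed
    by_cases hj : j = i
    · simp only [hj, true_and]
      exact isClosed_Icc.inter hVo.isClosed_compl
    · simp only [hj, false_and, not_false_iff, and_true]
      exact isClosed_Icc
  have hmem : ∀ j, ∀ᶠ q in 𝓝 ((γ i).extend t),
      q ∉ (γ j).extend '' {s | s ∈ Icc (0 : ℝ) 1 ∧ ¬ (j = i ∧ s ∈ V)} := by
    intro j
    refine (hK j).isOpen_compl.mem_nhds ?_
    rintro ⟨s, ⟨hs, hns⟩, he⟩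
    obtain ⟨rfl, rfl⟩ := h.eq_of_extend_eq ht hs he
    exact hns ⟨rfl, htV⟩
  filter_upwards [eventually_all.2 hmem] with q hq hqS
  rw [h.frontier_eq, mem_iUnion] at hqS
  obtain ⟨j, hj⟩ := hqS
  rw [range_eq_image_extend] at hj
  obtain ⟨s, hs, rfl⟩ := hj
  by_cases hn : j = i ∧ s ∈ V
  · obtain ⟨rfl, hsV⟩ := hn
    exact hVp s hsV
  · exact absurd ⟨s, ⟨hs, hn⟩, rfl⟩ (hq j)

/-- Where the velocity `v` of the boundary has a nonzero first component, `S` lies on the side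
of the curve given by the vertical vector `(0, v.1)`. -/
theorem IsOrientedBoundary.eventually_vertical (h : IsOrientedBoundary S γ) {i : Fin m} {t : ℝ}
    (ht : t ∈ Ioo (0 : ℝ) 1) {v : ℝ × ℝ} (hv : HasDerivAt (γ i).extend v t) (hv1 : v.1 ≠ 0) :
    ∀ᶠ s in 𝓝[>] (0 : ℝ), (γ i).extend t + s • ((0, v.1) : ℝ × ℝ) ∈ S ∧
      (γ i).extend t - s • ((0, v.1) : ℝ × ℝ) ∉ S := by
  set p := (γ i).extend t
  have hv0 : v ≠ 0 := fun h0 => hv1 (by simp [h0])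
  have hM : 0 < |v.1| + |v.2| := by positivity
  -- The cone about the tangent is taken so narrow that it misses every direction between the
  -- vertical `(0, v.1)` and the normal `rot v`: these have normal component at least `v.1 ^ 2` and
  -- norm at most `|v.1| + |v.2|`.
  obtain ⟨ε, hε, hεM⟩ : ∃ ε > 0, ε * (|v.1| + |v.2|) < v.1 ^ 2 :=
    ⟨v.1 ^ 2 / (2 * (|v.1| + |v.2|)), by positivity, by
      have : 0 < v.1 ^ 2 := by positivity
      field_simp; linarith⟩
  obtain ⟨r, hr, hfr⟩ := Metric.eventually_nhds_iff.1
    (h.eventually_frontier ht (p := fun q => |-v.2 * (q.1 - p.1) + v.1 * (q.2 - p.2)| ≤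
      ε * ‖q - p‖) (eventually_mem_cone hv hv0 hε))
  -- The segment of directions from `(0, v.1)` to `rot v`. Its small nonzero multiples avoid the
  -- frontier, so both ends lie on the same side of it.
  let w : ℝ → ℝ × ℝ := fun l => (-(l * v.2), v.1)
  have hw : ∀ l ∈ Icc (0 : ℝ) 1, ‖w l‖ ≤ |v.1| + |v.2| := by
    intro l hl
    rw [Prod.norm_def]
    refine max_le ?_ (by simp [w])
    simp only [w, norm_neg, norm_mul, Real.norm_eq_abs, abs_of_nonneg hl.1]
    nlinarith [abs_nonneg v.1, abs_nonneg v.2, hl.2]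
  have hfr' : ∀ l ∈ Icc (0 : ℝ) 1, ∀ s : ℝ, s ≠ 0 → |s| < r / (|v.1| + |v.2|) →
      p + s • w l ∉ frontier S := by
    intro l hl s hs0 hs hmem
    rw [lt_div_iff₀ hM] at hs
    have hnorm : ‖s • w l‖ ≤ |s| * (|v.1| + |v.2|) := by
      rw [norm_smul, Real.norm_eq_abs]
      exact mul_le_mul_of_nonneg_left (hw l hl) (abs_nonneg s)
    have h1 := hfr (y := p + s • w l) (by
      rw [dist_eq_norm, add_sub_cancel_left]; exact hnorm.trans_lt hs) hmem
    have e : -v.2 * ((p + s • w l).1 - p.1) + v.1 * ((p + s • w l).2 - p.2) =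
        s * (l * v.2 ^ 2 + v.1 ^ 2) := by
      simp [w]; ring
    rw [e, add_sub_cancel_left, abs_mul,
      abs_of_nonneg (a := l * v.2 ^ 2 + v.1 ^ 2) (by have := hl.1; positivity)] at h1
    have hs' : 0 < |s| := abs_pos.2 hs0
    have h2 : ε * ‖s • w l‖ ≤ |s| * (ε * (|v.1| + |v.2|)) := by
      calc ε * ‖s • w l‖ ≤ ε * (|s| * (|v.1| + |v.2|)) := by gcongr
        _ = _ := by ring
    have h3 : |s| * (ε * (|v.1| + |v.2|)) < |s| * (l * v.2 ^ 2 + v.1 ^ 2) := by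
      refine mul_lt_mul_of_pos_left ?_ hs'
      have := mul_nonneg hl.1 (sq_nonneg v.2)
      linarith
    linarith
  have hconn : ∀ s : ℝ, IsPreconnected ((fun l => p + s • w l) '' Icc (0 : ℝ) 1) := fun s =>
    isPreconnected_Icc.image _ (by fun_prop)
  have hw0 : w 0 = (0, v.1) := by simp [w]
  have hw1 : w 1 = rot v := by simp [w, rot]
  have hdisj : ∀ s : ℝ, s ≠ 0 → |s| < r / (|v.1| + |v.2|) →
      Disjoint ((fun l => p + s • w l) '' Icc (0 : ℝ) 1) (frontier S) := by
    intro s hs0 hs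
    rw [Set.disjoint_left]
    rintro _ ⟨l, hl, rfl⟩
    exact hfr' l hl s hs0 hs
  have hleft := h.left i t ht hv.differentiableAt
  rw [hv.deriv] at hleft
  have hsmall : ∀ᶠ s in 𝓝[>] (0 : ℝ), s < r / (|v.1| + |v.2|) :=
    mem_nhdsWithin_of_mem_nhds (Iio_mem_nhds (by positivity))
  filter_upwards [hleft, hsmall, self_mem_nhdsWithin] with s hs hsr hs0
  have hs0 : 0 < s := hs0
  have h0 : (0 : ℝ) ∈ Icc (0 : ℝ) 1 := by simp
  have h1 : (1 : ℝ) ∈ Icc (0 : ℝ) 1 := by simp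
  constructor
  · rw [← hw0]
    refine subset_of_isPreconnected_of_disjoint_frontier (hconn s)
      (hdisj s hs0.ne' (by rwa [abs_of_pos hs0])) ⟨p + s • w 1, ⟨1, h1, rfl⟩, ?_⟩
      ⟨0, h0, rfl⟩
    rw [hw1]; exact hs.1
  -- The same transport on the opposite side: membership at the vertical end would carry over to the
  -- right normal, contrary to the orientation.
  · intro hmem
    refine hs.2 ?_
    rw [← hw1]
    refine subset_of_isPreconnected_of_disjoint_frontier (hconn (-s))
      (hdisj (-s) (neg_ne_zero.2 hs0.ne') (by rwa [abs_neg, abs_of_pos hs0]))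
      ⟨p + (-s) • w 0, ⟨0, h0, rfl⟩, ?_⟩ ⟨1, h1, ?_⟩
    · rw [hw0, neg_smul, ← sub_eq_add_neg]; exact hmem
    · simp only [neg_smul, sub_eq_add_neg]; rfl

/-! ### Counting boundary points on a line -/

/-- A function on the line that is constant on a punctured neighbourhood of every point is
constant up to its values at isolated points. -/
theorem eq_of_forall_eventually_punctured {d D : ℝ → ℝ}
    (h : ∀ y, ∀ᶠ v in 𝓝[≠] y, d v = D y) (x y : ℝ) : D x = D y := by
  refine IsLocallyConstant.apply_eq_of_preconnectedSpace
    ((IsLocallyConstant.iff_eventually_eq D).2 fun y => ?_) x y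
  have h1 := eventually_eventually_nhdsWithin.2 (h y)
  rw [eventually_nhdsWithin_iff] at h1
  filter_upwards [h1] with v hv
  by_cases hvy : v = y
  · rw [hvy]
  -- Near `v ≠ y` the function `d` takes the value `D y`, and it also takes the value `D v`; hence
  -- `D` is locally constant.
  have h2 : ∀ᶠ w in 𝓝[≠] v, d w = D y :=
    (eventually_nhdsWithin_of_eventually_nhds
      (eventually_nhdsWithin_iff.1 (hv hvy))).mp ?_
  · obtain ⟨w, hw1, hw2⟩ := (h2.and (h v)).exists
    exact hw2.symm.trans hw1
  · filter_upwards [mem_nhdsWithin_of_mem_nhds (isOpen_ne.mem_nhds hvy)] with w hw hw'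
    exact hw' hw

/-- Substitute `s = (v - y) / c`. -/
theorem eventually_nhdsGT_of_pos {p : ℝ → Prop} {y c : ℝ} (hc : 0 < c)
    (h : ∀ᶠ s in 𝓝[>] (0 : ℝ), p (y + s * c)) : ∀ᶠ v in 𝓝[>] y, p v := by
  have ht : Tendsto (fun v => (v - y) / c) (𝓝[>] y) (𝓝[>] 0) := by
    refine tendsto_nhdsWithin_iff.2 ⟨?_, ?_⟩
    · have : Tendsto (fun v => (v - y) / c) (𝓝 y) (𝓝 ((y - y) / c)) :=
        Continuous.tendsto (by fun_prop) y
      rw [sub_self, zero_div] at this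
      exact this.mono_left nhdsWithin_le_nhds
    · filter_upwards [self_mem_nhdsWithin] with v hv
      exact div_pos (sub_pos.2 hv) hc
  filter_upwards [ht.eventually h] with v hv
  rwa [div_mul_cancel₀ _ hc.ne', add_sub_cancel] at hv

theorem eventually_nhdsLT_of_neg {p : ℝ → Prop} {y c : ℝ} (hc : c < 0)
    (h : ∀ᶠ s in 𝓝[>] (0 : ℝ), p (y + s * c)) : ∀ᶠ v in 𝓝[<] y, p v := by
  have ht : Tendsto (fun v => (v - y) / c) (𝓝[<] y) (𝓝[>] 0) := by
    refine tendsto_nhdsWithin_iff.2 ⟨?_, ?_⟩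
    · have : Tendsto (fun v => (v - y) / c) (𝓝 y) (𝓝 ((y - y) / c)) :=
        Continuous.tendsto (by fun_prop) y
      rw [sub_self, zero_div] at this
      exact this.mono_left nhdsWithin_le_nhds
    · filter_upwards [self_mem_nhdsWithin] with v hv
      exact div_pos_of_neg_of_neg (sub_neg.2 hv) hc
  filter_upwards [ht.eventually h] with v hv
  rwa [div_mul_cancel₀ _ hc.ne, add_sub_cancel] at hv

/-- The characteristic function of a set `K` bounded below on the line counts its signed boundary
points: `e a` are the boundary points, `σ a > 0` if `K` lies above `e a`, and `σ a < 0` if it lies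
below. -/
theorem indicator_eq_sum_sign {α : Type*} {K : Set ℝ} (hK : BddBelow K) (F : Finset α)
    (e σ : α → ℝ) (he : InjOn e F) (hσ : ∀ a ∈ F, σ a ≠ 0)
    (hfr : ∀ y, y ∉ e '' F → (∀ᶠ v in 𝓝 y, v ∈ K) ∨ (∀ᶠ v in 𝓝 y, v ∉ K))
    (hside : ∀ a ∈ F, ∀ᶠ s in 𝓝[>] (0 : ℝ), e a + s * σ a ∈ K ∧ e a - s * σ a ∉ K)
    {y : ℝ} (hy : y ∉ e '' F) :
    K.indicator 1 y = ∑ a ∈ F, if e a < y then (SignType.sign (σ a) : ℝ) else 0 := by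
  classical
  let ψ : α → ℝ → ℝ := fun a y => if e a < y then (SignType.sign (σ a) : ℝ) else 0
  -- At each `e a` the indicator and the term `ψ a` have the same jump, so `d` is constant up to
  -- isolated values; it vanishes below all of `K` and `e '' F`.
  let d : ℝ → ℝ := fun y => K.indicator 1 y - ∑ a ∈ F, ψ a y
  have hψ : ∀ a y, e a ≠ y → ∀ᶠ v in 𝓝 y, ψ a v = ψ a y := by
    intro a y hne
    rcases hne.lt_or_gt with hlt | hlt
    · filter_upwards [Ioi_mem_nhds hlt] with v hv
      simp only [ψ, if_pos hlt, if_pos (mem_Ioi.1 hv)]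
    · filter_upwards [Iio_mem_nhds hlt] with v hv
      simp only [ψ, if_neg hlt.not_gt, if_neg (mem_Iio.1 hv).not_gt]
  have hreg : ∀ y, y ∉ e '' F → ∀ᶠ v in 𝓝 y, d v = d y := by
    intro y hy
    have h1 : ∀ᶠ v in 𝓝 y, ∀ a ∈ F, ψ a v = ψ a y :=
      (Filter.eventually_all_finset F).2 fun a ha => hψ a y fun h => hy ⟨a, ha, h⟩
    have h2 : ∀ᶠ v in 𝓝 y, K.indicator (1 : ℝ → ℝ) v = K.indicator 1 y := by
      rcases hfr y hy with h | h
      · filter_upwards [h] with v hv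
        rw [indicator_of_mem hv, indicator_of_mem h.self_of_nhds]; rfl
      · filter_upwards [h] with v hv
        rw [indicator_of_notMem hv, indicator_of_notMem h.self_of_nhds]
    filter_upwards [h1, h2] with v h1 h2
    simp only [d, h2, Finset.sum_congr rfl h1]
  have hsing : ∀ y, y ∈ e '' F → ∃ c, ∀ᶠ v in 𝓝[≠] y, d v = c := by
    rintro _ ⟨a, ha, rfl⟩
    have h1 : ∀ᶠ v in 𝓝 (e a), ∀ b ∈ F.erase a, ψ b v = ψ b (e a) :=
      (Filter.eventually_all_finset _).2 fun b hb => hψ b _ fun h =>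
        Finset.ne_of_mem_erase hb (he (Finset.mem_of_mem_erase hb) ha h)
    have h2 : ∃ c, ∀ᶠ v in 𝓝[≠] (e a), K.indicator 1 v - ψ a v = c := by
      simp_rw [← Iio_union_Ioi, nhdsWithin_union, eventually_sup]
      have hin := (hside a ha).mono fun _ h => h.1
      have hout : ∀ᶠ s in 𝓝[>] (0 : ℝ), e a + s * -σ a ∉ K :=
        (hside a ha).mono fun s h => by rw [mul_neg, ← sub_eq_add_neg]; exact h.2
      rcases (hσ a ha).lt_or_gt with hs | hs
      · refine ⟨1, ?_, ?_⟩
        · filter_upwards [eventually_nhdsLT_of_neg hs hin, self_mem_nhdsWithin] with v hv hlt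
          simp [ψ, hv, (mem_Iio.1 hlt).not_gt]
        · filter_upwards [eventually_nhdsGT_of_pos (p := (· ∉ K)) (neg_pos.2 hs) hout,
            self_mem_nhdsWithin] with v hv hlt
          simp [ψ, hv, mem_Ioi.1 hlt, sign_neg hs]
      · refine ⟨0, ?_, ?_⟩
        · filter_upwards [eventually_nhdsLT_of_neg (p := (· ∉ K)) (neg_lt_zero.2 hs) hout,
            self_mem_nhdsWithin] with v hv hlt
          simp [ψ, hv, (mem_Iio.1 hlt).not_gt]
        · filter_upwards [eventually_nhdsGT_of_pos hs hin, self_mem_nhdsWithin] with v hv hlt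
          simp [ψ, hv, mem_Ioi.1 hlt, sign_pos hs]
    obtain ⟨c, hc⟩ := h2
    refine ⟨c - ∑ b ∈ F.erase a, ψ b (e a), ?_⟩
    filter_upwards [hc, mem_nhdsWithin_of_mem_nhds h1] with v hv h1
    simp only [d]
    rw [← Finset.add_sum_erase F _ ha, Finset.sum_congr rfl h1, ← hv]
    ring
  have hex : ∀ y, ∃ c, ∀ᶠ v in 𝓝[≠] y, d v = c := by
    intro y
    by_cases hy : y ∈ e '' F
    · exact hsing y hy
    · exact ⟨d y, mem_nhdsWithin_of_mem_nhds (hreg y hy)⟩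
  choose D hD using hex
  have hDd : ∀ y, y ∉ e '' F → D y = d y := by
    intro y hy
    obtain ⟨v, h1, h2⟩ := ((hD y).and (mem_nhdsWithin_of_mem_nhds (hreg y hy))).exists
    exact h1.symm.trans h2
  obtain ⟨b, hb⟩ := hK.union (F.finite_toSet.image e).bddBelow
  have hlow : ∀ z ∈ K ∪ e '' F, b - 1 < z := fun z hz => (sub_one_lt b).trans_le (hb hz)
  have hb' : b - 1 ∉ e '' F := fun h => lt_irrefl _ (hlow _ (Or.inr h))
  have h0 : d (b - 1) = 0 := by
    have hbK : b - 1 ∉ K := fun h => lt_irrefl _ (hlow _ (Or.inl h))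
    simp only [d, ψ, indicator_of_notMem hbK, zero_sub, neg_eq_zero]
    exact Finset.sum_eq_zero fun a ha => if_neg (hlow _ (Or.inr ⟨a, ha, rfl⟩)).not_gt
  have : d y = 0 := by
    rw [← hDd y hy, eq_of_forall_eventually_punctured hD y (b - 1), hDd _ hb', h0]
  exact sub_eq_zero.1 this

/-! ### Green's theorem for `f dx` -/

/-- The parameters at which a path has a velocity that is not vertical. -/
def nonverticalParams {a b : ℝ × ℝ} (c : Path a b) : Set ℝ :=
  {t | t ∈ Ioo (0 : ℝ) 1 ∧ DifferentiableAt ℝ c.extend t ∧ (deriv c.extend t).1 ≠ 0}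

theorem measurableSet_nonverticalParams {a b : ℝ × ℝ} (c : Path a b) :
    MeasurableSet (nonverticalParams c) :=
  measurableSet_Ioo.inter ((measurableSet_of_differentiableAt ℝ _).inter
    ((measurable_deriv c.extend).fst (measurableSet_singleton 0).compl))

theorem hasDerivAt_extend_fst {a b : ℝ × ℝ} {c : Path a b} {t : ℝ}
    (h : DifferentiableAt ℝ c.extend t) :
    HasDerivAt (fun s => (c.extend s).1) (deriv c.extend t).1 t :=
  (ContinuousLinearMap.fst ℝ ℝ ℝ).hasFDerivAt.comp_hasDerivAt t h.hasDerivAt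

/-- Almost every vertical line meets a piecewise `C¹` path only where the velocity exists and is
not vertical. -/
theorem IsPiecewiseC1.ae_mem_nonverticalParams {a b : ℝ × ℝ} {c : Path a b}
    (hc : IsPiecewiseC1 c) :
    ∀ᵐ x : ℝ, ∀ t ∈ Icc (0 : ℝ) 1, (c.extend t).1 = x → t ∈ nonverticalParams c := by
  obtain ⟨B, hB, hd⟩ := hc.exists_finite_differentiableAt
  let C : Set ℝ := {t | DifferentiableAt ℝ c.extend t ∧ (deriv c.extend t).1 = 0}
  -- The one-dimensional Sard lemma: critical values of the first coordinate form a null set.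
  have hC : volume ((fun t => (c.extend t).1) '' C) = 0 := by
    refine addHaar_image_eq_zero_of_det_fderivWithin_eq_zero volume
      (f' := fun t => ContinuousLinearMap.toSpanSingleton ℝ (deriv c.extend t).1)
      (fun t ht => (hasDerivAt_extend_fst ht.1).hasFDerivAt.hasFDerivWithinAt) fun t ht => ?_
    simp [ht.2]
  have hF : volume ((fun t => (c.extend t).1) '' (B ∪ {0, 1})) = 0 :=
    ((hB.union (toFinite _)).image _).measure_zero _
  filter_upwards [measure_eq_zero_iff_ae_notMem.1 hC, measure_eq_zero_iff_ae_notMem.1 hF]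
    with x hxC hxF t ht hxt
  have htF : t ∉ B ∪ {0, 1} := fun h => hxF ⟨t, h, hxt⟩
  simp only [mem_union, mem_insert_iff, mem_singleton_iff, not_or] at htF
  have ht' : t ∈ Ioo (0 : ℝ) 1 :=
    ⟨ht.1.lt_of_ne (Ne.symm htF.2.1), ht.2.lt_of_ne htF.2.2⟩
  have hdt := hd t ht' htF.1
  exact ⟨ht', hdt, fun h => hxC ⟨t, ⟨hdt, h⟩, hxt⟩⟩

/-- An infinite fibre in the compact interval would accumulate at one of its points, but a nonzero
derivative isolates each point in its fibre. -/
theorem finite_setOf_extend_fst_eq {a b : ℝ × ℝ} {c : Path a b} {x : ℝ}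
    (h : ∀ t ∈ Icc (0 : ℝ) 1, (c.extend t).1 = x → t ∈ nonverticalParams c) :
    {t | t ∈ nonverticalParams c ∧ (c.extend t).1 = x}.Finite := by
  have hcont : Continuous fun t => (c.extend t).1 := by fun_prop
  have hZ : IsCompact (Icc (0 : ℝ) 1 ∩ {t | (c.extend t).1 = x}) :=
    isCompact_Icc.inter_right (isClosed_eq hcont continuous_const)
  refine Finite.subset (s := Icc (0 : ℝ) 1 ∩ {t | (c.extend t).1 = x}) ?_
    fun t ht => ⟨Ioo_subset_Icc_self ht.1.1, ht.2⟩
  by_contra hinf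
  obtain ⟨t, ht, hacc⟩ := Set.Infinite.exists_accPt_of_subset_isCompact hinf hZ subset_rfl
  obtain ⟨-, hd, h0⟩ := h t ht.1 ht.2
  have hne : ∀ᶠ s in 𝓝[≠] t, (c.extend s).1 ≠ x := (hasDerivAt_extend_fst hd).eventually_ne h0
  obtain ⟨s, hs, hs'⟩ := ((accPt_iff_frequently_nhdsNE.1 hacc).and_eventually hne).exists
  exact hs' hs.2

/-- On a vertical line that meets the boundary only where its velocity exists and is not vertical,
the characteristic function of `S` counts the boundary points below with their signs. -/
theorem IsOrientedBoundary.indicator_slice (h : IsOrientedBoundary S γ) (hS : IsCompact S) {x : ℝ}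
    (hx : ∀ i, ∀ t ∈ Icc (0 : ℝ) 1, ((γ i).extend t).1 = x → t ∈ nonverticalParams (γ i))
    {T : Fin m → Finset ℝ}
    (hT : ∀ i t, t ∈ T i ↔ t ∈ nonverticalParams (γ i) ∧ ((γ i).extend t).1 = x) :
    ∀ᵐ y : ℝ, S.indicator (1 : ℝ × ℝ → ℝ) (x, y) = ∑ i, ∑ t ∈ T i,
      if ((γ i).extend t).2 < y then (SignType.sign (deriv (γ i).extend t).1 : ℝ) else 0 := by
  let F : Finset (Σ _ : Fin m, ℝ) := Finset.univ.sigma T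
  let e : (Σ _ : Fin m, ℝ) → ℝ := fun a => ((γ a.1).extend a.2).2
  have hmem : ∀ a, a ∈ F ↔ a.2 ∈ nonverticalParams (γ a.1) ∧ ((γ a.1).extend a.2).1 = x :=
    fun a => by simp [F, hT]
  have hpt : ∀ a ∈ F, (γ a.1).extend a.2 = (x, e a) := fun a ha =>
    Prod.ext ((hmem a).1 ha).2 rfl
  have hK : BddBelow {y | (x, y) ∈ S} := by
    refine (hS.image continuous_snd).bddBelow.mono ?_
    intro y hy
    exact ⟨(x, y), hy, rfl⟩
  have he : InjOn e F := by
    rintro ⟨j, s⟩ ha ⟨i, t⟩ hb hab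
    have hb' := ((hmem _).1 hb).1.1
    have ha' := Ioo_subset_Icc_self ((hmem _).1 ha).1.1
    obtain ⟨rfl, rfl⟩ := h.eq_of_extend_eq (i := i) (j := j) hb' ha'
      (((hpt _ ha).trans (by rw [hab])).trans (hpt _ hb).symm)
    rfl
  have hcont : Continuous fun v : ℝ => (x, v) := by fun_prop
  have hfr : ∀ y, y ∉ e '' F →
      (∀ᶠ v in 𝓝 y, v ∈ {y | (x, y) ∈ S}) ∨ (∀ᶠ v in 𝓝 y, v ∉ {y | (x, y) ∈ S}) := by
    intro y hy
    have hnf : (x, y) ∉ frontier S := by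
      rw [h.frontier_eq, mem_iUnion]
      rintro ⟨i, hi⟩
      rw [range_eq_image_extend] at hi
      obtain ⟨t, ht, hxy⟩ := hi
      have h1 : ((γ i).extend t).1 = x := by rw [hxy]
      exact hy ⟨⟨i, t⟩, (hmem _).2 ⟨hx i t ht h1, h1⟩, by simp [e, hxy]⟩
    by_cases hi : (x, y) ∈ interior S
    · left
      filter_upwards [hcont.continuousAt.preimage_mem_nhds (isOpen_interior.mem_nhds hi)]
        with v hv
      exact interior_subset hv
    · right
      have hc : (x, y) ∈ (closure S)ᶜ := fun hc => hnf ⟨hc, hi⟩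
      filter_upwards [hcont.continuousAt.preimage_mem_nhds
        (isClosed_closure.isOpen_compl.mem_nhds hc)] with v hv hvS
      exact hv (subset_closure hvS)
  have hside : ∀ a ∈ F, ∀ᶠ s in 𝓝[>] (0 : ℝ),
      e a + s * (deriv (γ a.1).extend a.2).1 ∈ {y | (x, y) ∈ S} ∧
        e a - s * (deriv (γ a.1).extend a.2).1 ∉ {y | (x, y) ∈ S} := by
    intro a ha
    obtain ⟨ht, hd, h0⟩ := ((hmem a).1 ha).1
    have := h.eventually_vertical ht hd.hasDerivAt h0
    rw [hpt a ha] at this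
    simpa using this
  filter_upwards [measure_eq_zero_iff_ae_notMem.1 ((F.finite_toSet.image e).measure_zero volume)]
    with y hy
  have := indicator_eq_sum_sign hK F e (fun a => (deriv (γ a.1).extend a.2).1) he
    (fun a ha => ((hmem a).1 ha).1.2.2) hfr hside hy
  rw [Finset.sum_sigma] at this
  exact this

theorem hasCompactSupport_vertical {f : ℝ × ℝ → ℝ} (hf : HasCompactSupport f) (x : ℝ) :
    HasCompactSupport fun y => f (x, y) := by
  refine HasCompactSupport.intro (hf.isCompact.image continuous_snd) fun y hy => ?_
  by_contra h
  exact hy ⟨(x, y), subset_tsupport f h, rfl⟩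

/-- The fundamental theorem on `(e, ∞)`; compact support removes the term at infinity. -/
theorem integral_ite_mul_partialY {f : ℝ × ℝ → ℝ} (hf : ContDiff ℝ 1 f)
    (hfc : HasCompactSupport f) (x e c : ℝ) :
    Integrable (fun y => (if e < y then c else 0) * partialY f (x, y)) ∧
      ∫ y, (if e < y then c else 0) * partialY f (x, y) = c * -f (x, e) := by
  have hf' : ContDiff ℝ 1 fun y => f (x, y) := hf.comp (by fun_prop)
  have hfc' := hasCompactSupport_vertical hfc x
  have heq : (fun y => (if e < y then c else 0) * partialY f (x, y)) =
      (Ioi e).indicator fun y => c * deriv (fun y => f (x, y)) y := by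
    funext y
    by_cases h : e < y <;> simp [indicator, h, partialY]
  have hint : Integrable fun y => c * deriv (fun y => f (x, y)) y :=
    ((hf'.continuous_deriv le_rfl).integrable_of_hasCompactSupport hfc'.deriv).const_mul c
  rw [heq]
  refine ⟨hint.indicator measurableSet_Ioi, ?_⟩
  rw [integral_indicator measurableSet_Ioi, integral_const_mul, hfc'.integral_Ioi_deriv_eq hf']

theorem hasCompactSupport_partialY {f : ℝ × ℝ → ℝ} (hf : ContDiff ℝ 1 f)
    (hfc : HasCompactSupport f) : Continuous (partialY f) ∧ HasCompactSupport (partialY f) := by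
  have : partialY f = fun p => fderiv ℝ f p (0, 1) :=
    funext fun p => partialY_eq_fderiv (hf.differentiable one_ne_zero p)
  rw [this]
  exact ⟨(hf.continuous_fderiv one_ne_zero).clm_apply continuous_const,
    hfc.fderiv_apply (𝕜 := ℝ) (0, 1)⟩

/-- Fubini along vertical lines, the signed count of crossings on each line, then the area formula.
-/
theorem IsOrientedBoundary.integral_partialY_of_hasCompactSupport (h : IsOrientedBoundary S γ)
    (hS : IsCompact S) {f : ℝ × ℝ → ℝ} (hf : ContDiff ℝ 1 f) (hfc : HasCompactSupport f) :
    ∫ p in S, partialY f p =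
      -∑ i, ∫ t in (0 : ℝ)..1, f ((γ i).extend t) * (deriv (γ i).extend t).1 := by
  have hpc : ∀ i, IsPiecewiseC1 (γ i) := fun i => (h.piecewise_regular i).isPiecewiseC1
  have hgood := ae_all_iff.2 fun i => (hpc i).ae_mem_nonverticalParams
  obtain ⟨hcont, hcs⟩ := hasCompactSupport_partialY hf hfc
  -- The default `∅` is used only for `x` in a null set.
  let T : Fin m → ℝ → Finset ℝ := fun i x => by
    classical
    exact if hfin : {t | t ∈ nonverticalParams (γ i) ∧ ((γ i).extend t).1 = x}.Finite
      then hfin.toFinset else ∅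
  have hT : ∀ᵐ x : ℝ, ∀ i t,
      t ∈ T i x ↔ t ∈ nonverticalParams (γ i) ∧ ((γ i).extend t).1 = x := by
    filter_upwards [hgood] with x hx i t
    simp [T, finite_setOf_extend_fst_eq (hx i)]
  let G : Fin m → ℝ → ℝ := fun i t =>
    (SignType.sign (deriv (γ i).extend t).1 : ℝ) * -f ((γ i).extend t)
  have hGeq : ∀ i t, |(deriv (γ i).extend t).1| * G i t =
      -(f ((γ i).extend t) * (deriv (γ i).extend t).1) := by
    intro i t
    simp only [G]
    rw [← mul_assoc, abs_mul_sign]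
    ring
  have hint : ∀ i, IntegrableOn
      (fun t => -(f ((γ i).extend t) * (deriv (γ i).extend t).1)) (Ioc 0 1) := by
    intro i
    have := (hpc i).intervalIntegrable (α := fun t => f ((γ i).extend t) • dx)
      (by have := hf.continuous; fun_prop)
    rw [intervalIntegrable_iff_integrableOn_Ioc_of_le zero_le_one] at this
    simpa [dx] using this.neg
  have hsub : ∀ i, nonverticalParams (γ i) ⊆ Ioc 0 1 := fun i t ht => Ioo_subset_Ioc_self ht.1
  have hslice : ∀ᵐ x : ℝ, ∫ y, S.indicator (partialY f) (x, y) = ∑ i, ∑ t ∈ T i x, G i t := by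
    filter_upwards [hgood, hT] with x hx hTx
    have hae : ∀ᵐ y : ℝ, S.indicator (partialY f) (x, y) = ∑ i, ∑ t ∈ T i x,
        (if ((γ i).extend t).2 < y then (SignType.sign (deriv (γ i).extend t).1 : ℝ) else 0) *
          partialY f (x, y) := by
      filter_upwards [h.indicator_slice hS hx hTx] with y hy
      simp_rw [← Finset.sum_mul]
      rw [← hy]
      by_cases hxy : (x, y) ∈ S <;> simp [hxy]
    rw [integral_congr_ae hae, integral_finsetSum _ fun i _ => integrable_finsetSum _ fun t _ =>
      (integral_ite_mul_partialY hf hfc _ _ _).1]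
    refine Finset.sum_congr rfl fun i _ => ?_
    rw [integral_finsetSum _ fun t _ => (integral_ite_mul_partialY hf hfc _ _ _).1]
    refine Finset.sum_congr rfl fun t ht => ?_
    rw [(integral_ite_mul_partialY hf hfc _ _ _).2, ← ((hTx i t).1 ht).2]
  rw [← integral_indicator hS.measurableSet, Measure.volume_eq_prod, integral_prod _
    ((hcont.integrable_of_hasCompactSupport hcs).indicator hS.measurableSet),
    integral_congr_ae hslice,
    integral_sum_fibers (u := fun i t => ((γ i).extend t).1)
      (u' := fun i t => (deriv (γ i).extend t).1)
      (fun i => measurableSet_nonverticalParams (γ i))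
      (fun i t ht => (hasDerivAt_extend_fst ht.2.1).hasDerivWithinAt) (fun i t ht => ht.2.2)
      (fun i => by simp only [hGeq]; exact (hint i).mono_set (hsub i)) hT,
    ← Finset.sum_neg_distrib]
  refine Finset.sum_congr rfl fun i _ => ?_
  simp only [hGeq]
  rw [intervalIntegral.integral_of_le zero_le_one, ← integral_neg]
  -- Apart from finitely many parameters, those left out have vertical or zero velocity and
  -- contribute nothing to `f dx`.
  refine (setIntegral_eq_of_subset_of_ae_sdiff_eq_zero measurableSet_Ioc.nullMeasurableSet
    (hsub i) ?_).symm
  obtain ⟨B, hB, hd⟩ := (hpc i).exists_finite_differentiableAt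
  filter_upwards [measure_eq_zero_iff_ae_notMem.1 ((hB.insert 1).measure_zero volume)]
    with t ht htd
  rw [mem_insert_iff, not_or] at ht
  have ht' : t ∈ Ioo (0 : ℝ) 1 := ⟨htd.1.1, htd.1.2.lt_of_ne ht.1⟩
  have h0 : (deriv (γ i).extend t).1 = 0 := by
    by_contra h0
    exact htd.2 ⟨ht', hd t ht' ht.2, h0⟩
  rw [h0, mul_zero, neg_zero]

/-! ### Green's theorem -/

/-- Multiply by a smooth cutoff equal to `1` near `S`. Agreement on neighbourhoods, not only on `S`,
makes the partial derivatives agree too. -/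
theorem exists_contDiff_hasCompactSupport_eqOn {S U : Set (ℝ × ℝ)} (hS : IsCompact S)
    (hU : IsOpen U) (hSU : S ⊆ U) {f : ℝ × ℝ → ℝ} (hf : ContDiffOn ℝ 1 f U) :
    ∃ F : ℝ × ℝ → ℝ, ContDiff ℝ 1 F ∧ HasCompactSupport F ∧ ∀ p ∈ S, F =ᶠ[𝓝 p] f := by
  obtain ⟨L, hL, hSL, hLU⟩ := exists_compact_between hS hU hSU
  obtain ⟨χ, hχ1, hχ0, -⟩ := exists_contMDiffMap_one_nhds_of_subset_interior
    (n := 1) (modelWithCornersSelf ℝ (ℝ × ℝ)) hS.isClosed hSL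
  have hχ : ContDiff ℝ 1 χ := contMDiff_iff_contDiff.1 χ.contMDiff
  refine ⟨fun p => χ p * f p, contDiff_iff_contDiffAt.2 fun p => ?_,
    HasCompactSupport.intro hL fun p hp => by rw [hχ0 p hp, zero_mul], fun p hp => ?_⟩
  · by_cases hp : p ∈ U
    · exact hχ.contDiffAt.mul (hf.contDiffAt (hU.mem_nhds hp))
    · have h0 : (fun p => χ p * f p) =ᶠ[𝓝 p] fun _ => 0 := by
        filter_upwards [hL.isClosed.isOpen_compl.mem_nhds fun h => hp (hLU h)] with q hq
        rw [hχ0 q hq, zero_mul]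
      exact contDiffAt_const.congr_of_eventuallyEq h0
  · filter_upwards [eventually_nhdsSet_iff_forall.1 hχ1 p hp] with q hq
    rw [hq, one_mul]

theorem partialY_congr {f F : ℝ × ℝ → ℝ} {p : ℝ × ℝ} (h : F =ᶠ[𝓝 p] f) :
    partialY F p = partialY f p := by
  have hc : Tendsto (fun y : ℝ => (p.1, y)) (𝓝 p.2) (𝓝 p) :=
    Continuous.tendsto (f := fun y : ℝ => (p.1, y)) (by fun_prop) p.2
  exact EventuallyEq.deriv_eq (hc.eventually h)

theorem IsOrientedBoundary.range_subset (h : IsOrientedBoundary S γ) (hS : IsCompact S)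
    (i : Fin m) : range (γ i) ⊆ S :=
  ((subset_iUnion (fun i => range (γ i)) i).trans h.frontier_eq.symm.subset).trans
    hS.isClosed.frontier_subset

theorem IsOrientedBoundary.integral_partialY (h : IsOrientedBoundary S γ) (hS : IsCompact S)
    {U : Set (ℝ × ℝ)} (hU : IsOpen U) (hSU : S ⊆ U) {f : ℝ × ℝ → ℝ} (hf : ContDiffOn ℝ 1 f U) :
    ∫ p in S, partialY f p =
      -∑ i, ∫ t in (0 : ℝ)..1, f ((γ i).extend t) * (deriv (γ i).extend t).1 := by
  obtain ⟨F, hF, hFc, hFf⟩ := exists_contDiff_hasCompactSupport_eqOn hS hU hSU hf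
  have := h.integral_partialY_of_hasCompactSupport hS hF hFc
  rw [setIntegral_congr_fun hS.measurableSet fun p hp => partialY_congr (hFf p hp)] at this
  rw [this]
  simp_rw [fun i t => (hFf _ (h.range_subset hS i (extend_mem_range (γ i) t))).self_of_nhds]

/-- Rotation by `π / 2` as a continuous linear automorphism of the plane. -/
def rotEquiv : (ℝ × ℝ) ≃L[ℝ] ℝ × ℝ :=
  ContinuousLinearEquiv.equivOfInverse
    ((-ContinuousLinearMap.snd ℝ ℝ ℝ).prod (ContinuousLinearMap.fst ℝ ℝ ℝ))
    ((ContinuousLinearMap.snd ℝ ℝ ℝ).prod (-ContinuousLinearMap.fst ℝ ℝ ℝ))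
    (fun p => by simp) (fun p => by simp)

theorem rotEquiv_apply (p : ℝ × ℝ) : rotEquiv p = rot p := rfl

theorem measurePreserving_rotEquiv_symm : MeasurePreserving rotEquiv.symm := by
  have h : MeasurePreserving (Prod.map id Neg.neg ∘ Prod.swap : ℝ × ℝ → ℝ × ℝ) :=
    ((MeasurePreserving.id volume).prod (Measure.measurePreserving_neg volume)).comp
      Measure.measurePreserving_swap
  exact h

theorem extend_map_rotEquiv {a b : ℝ × ℝ} (c : Path a b) :
    (c.map rotEquiv.continuous).extend = rotEquiv ∘ c.extend := rfl

/-- A quarter turn commutes with `rot`, so it carries left normals to left normals. -/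
theorem IsOrientedBoundary.rotate (h : IsOrientedBoundary S γ) :
    IsOrientedBoundary (rotEquiv.symm ⁻¹' S) fun i => (γ i).map rotEquiv.continuous where
  piecewise_regular i := by
    obtain ⟨n, t, ht, h0, h1, H⟩ := h.piecewise_regular i
    refine ⟨n, t, ht, h0, h1, fun k => ⟨rotEquiv.contDiff.comp_contDiffOn (H k).1, ?_⟩⟩
    intro s hs
    have hd := ((H k).1.differentiableOn one_ne_zero s hs).hasDerivWithinAt
    have hr := rotEquiv.toContinuousLinearMap.hasFDerivAt.comp_hasDerivWithinAt s hd
    rw [extend_map_rotEquiv]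
    refine (hr.derivWithin (uniqueDiffOn_Icc (ht k.castSucc_lt_succ) s hs)).trans_ne ?_
    exact fun h0 => (H k).2 s hs (rotEquiv.map_eq_zero_iff.1 h0)
  simple i := by
    rw [extend_map_rotEquiv]
    exact rotEquiv.injective.comp_injOn (h.simple i)
  disjoint i j hij := by
    simp only [Path.map_coe, range_comp]
    exact (disjoint_image_iff rotEquiv.injective).2 (h.disjoint i j hij)
  frontier_eq := by
    have h1 : frontier (rotEquiv.symm ⁻¹' S) = rotEquiv.symm ⁻¹' frontier S :=
      (rotEquiv.symm.toHomeomorph.preimage_frontier S).symm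
    rw [h1, h.frontier_eq]
    simp only [preimage_iUnion, Path.map_coe, range_comp]
    exact iUnion_congr fun i => (rotEquiv.image_eq_preimage_symm _).symm
  left i t ht hd := by
    rw [extend_map_rotEquiv] at hd ⊢
    rw [rotEquiv.comp_differentiableAt_iff] at hd
    have hder : deriv (rotEquiv ∘ (γ i).extend) t = rotEquiv (deriv (γ i).extend t) :=
      (rotEquiv.toContinuousLinearMap.hasFDerivAt.comp_hasDerivAt t hd.hasDerivAt).deriv
    filter_upwards [h.left i t ht hd] with s hs
    simpa only [hder, Function.comp_apply, mem_preimage, ← rotEquiv_apply, map_add, map_sub,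
      map_smul, ContinuousLinearEquiv.symm_apply_apply] using hs

theorem IsOrientedBoundary.integral_partialX (h : IsOrientedBoundary S γ) (hS : IsCompact S)
    {U : Set (ℝ × ℝ)} (hU : IsOpen U) (hSU : S ⊆ U) {g : ℝ × ℝ → ℝ} (hg : ContDiffOn ℝ 1 g U) :
    ∫ p in S, partialX g p =
      ∑ i, ∫ t in (0 : ℝ)..1, g ((γ i).extend t) * (deriv (γ i).extend t).2 := by
  have hS' : IsCompact (rotEquiv.symm ⁻¹' S) :=
    rotEquiv.symm.toHomeomorph.isCompact_preimage.2 hS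
  have key := h.rotate.integral_partialY hS' (hU.preimage rotEquiv.symm.continuous)
    (preimage_mono hSU) (hg.comp rotEquiv.symm.contDiff.contDiffOn (mapsTo_preimage _ _))
  rw [← measurePreserving_rotEquiv_symm.setIntegral_preimage_emb
    rotEquiv.symm.toHomeomorph.measurableEmbedding (partialX g) S]
  -- As `rotEquiv.symm (x, y) = (y, -x)`, the `y`-derivative of `g ∘ rotEquiv.symm` is by definition
  -- `partialX g` at the rotated point. The first component of a rotated velocity is minus the
  -- second of the original, which cancels the sign in `key`.
  refine Eq.trans key ?_
  rw [← Finset.sum_neg_distrib]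
  refine Finset.sum_congr rfl fun i _ => ?_
  rw [← intervalIntegral.integral_neg]
  obtain ⟨B, hB, hd⟩ := (h.piecewise_regular i).isPiecewiseC1.exists_finite_differentiableAt
  refine intervalIntegral.integral_congr_ae ?_
  rw [uIoc_of_le zero_le_one]
  filter_upwards [measure_eq_zero_iff_ae_notMem.1 ((hB.insert 1).measure_zero volume)]
    with t ht ht01
  rw [mem_insert_iff, not_or] at ht
  have hder : deriv (rotEquiv ∘ (γ i).extend) t = rotEquiv (deriv (γ i).extend t) :=
    (rotEquiv.toContinuousLinearMap.hasFDerivAt.comp_hasDerivAt t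
      (hd t ⟨ht01.1, ht01.2.lt_of_ne ht.1⟩ ht.2).hasDerivAt).deriv
  rw [extend_map_rotEquiv, hder]
  simp only [Function.comp_apply, ContinuousLinearEquiv.symm_apply_apply]
  rw [rotEquiv_apply, rot, mul_neg, neg_neg]

/-- Green's theorem. -/
theorem IsOrientedBoundary.green (h : IsOrientedBoundary S γ) (hS : IsCompact S)
    {U : Set (ℝ × ℝ)} (hU : IsOpen U) (hSU : S ⊆ U) {f g : ℝ × ℝ → ℝ} (hf : ContDiffOn ℝ 1 f U)
    (hg : ContDiffOn ℝ 1 g U) :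
    IntegrableOn (fun p => partialX g p - partialY f p) S ∧
      (∀ i, CurveIntegrable (oneForm f g) (γ i)) ∧
      ∫ p in S, (partialX g p - partialY f p) = boundaryIntegral (oneForm f g) γ := by
  have hX : IntegrableOn (partialX g) S :=
    ((continuousOn_partialX hU hg).mono hSU).integrableOn_compact hS
  have hY : IntegrableOn (partialY f) S :=
    ((continuousOn_partialY hU hf).mono hSU).integrableOn_compact hS
  have hpc : ∀ i, IsPiecewiseC1 (γ i) := fun i => (h.piecewise_regular i).isPiecewiseC1
  have hint : ∀ F : ℝ × ℝ → ℝ, ContDiffOn ℝ 1 F U → ∀ i, ∀ l : ℝ × ℝ →L[ℝ] ℝ,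
      IntervalIntegrable (fun t => F ((γ i).extend t) * l (deriv (γ i).extend t)) volume 0 1 := by
    intro F hF i l
    refine (hpc i).intervalIntegrable (α := fun t => F ((γ i).extend t) • l) ?_
    exact (hF.continuousOn.comp (γ i).continuous_extend.continuousOn fun t _ =>
      hSU (h.range_subset hS i (extend_mem_range (γ i) t))).smul continuousOn_const
  refine ⟨hX.sub hY, fun i => (hpc i).curveIntegrable ?_, ?_⟩
  · exact (continuousOn_oneForm hf.continuousOn hg.continuousOn).mono
      ((h.range_subset hS i).trans hSU)
  rw [integral_sub hX hY, h.integral_partialX hS hU hSU hg, h.integral_partialY hS hU hSU hf,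
    sub_neg_eq_add, add_comm, ← Finset.sum_add_distrib, boundaryIntegral]
  refine Finset.sum_congr rfl fun i _ => ?_
  rw [curveIntegral_eq_intervalIntegral_deriv]
  simp only [oneForm_apply]
  exact (intervalIntegral.integral_add (hint f hf i dx) (hint g hg i dy)).symm

end PlaneCalculus

theorem mainTheorem4 :
    -- gradient theorem: both identities from the squares, and the coordinate form
    (∀ (A B : ℝ × ℝ) (c : Path A B), PlaneCalculus.IsPiecewiseC1 c →
      ∀ U : Set (ℝ × ℝ), IsOpen U → Set.range c ⊆ U →
      ∀ f : ℝ × ℝ → ℝ, ContDiffOn ℝ 1 f U →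
        (CurveIntegrable (PlaneCalculus.dotDr (PlaneCalculus.grad f)) c ∧
          curveIntegral (PlaneCalculus.dotDr (PlaneCalculus.grad f)) c = f B - f A) ∧
        (CurveIntegrable (PlaneCalculus.hodge (PlaneCalculus.dotDr (PlaneCalculus.ham f))) c ∧
          curveIntegral (PlaneCalculus.hodge (PlaneCalculus.dotDr (PlaneCalculus.ham f))) c
            = f A - f B) ∧
        (CurveIntegrable
            (PlaneCalculus.oneForm (PlaneCalculus.partialX f) (PlaneCalculus.partialY f)) c ∧
          curveIntegral
            (PlaneCalculus.oneForm (PlaneCalculus.partialX f) (PlaneCalculus.partialY f)) c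
            = f B - f A)) ∧
    -- Green's theorem: both identities from the squares, and the coordinate form
    (∀ (S : Set (ℝ × ℝ)), IsCompact S →
      ∀ (m : ℕ) (P : Fin m → ℝ × ℝ) (γ : ∀ i, Path (P i) (P i)),
      PlaneCalculus.IsOrientedBoundary S γ →
      ∀ U : Set (ℝ × ℝ), IsOpen U → S ⊆ U →
        (∀ A : ℝ × ℝ → ℝ × ℝ, ContDiffOn ℝ 1 A U →
          (MeasureTheory.IntegrableOn (PlaneCalculus.curl3 A) S ∧
            (∀ i, CurveIntegrable (PlaneCalculus.dotDr A) (γ i)) ∧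
            ∫ p in S, PlaneCalculus.curl3 A p
              = PlaneCalculus.boundaryIntegral (PlaneCalculus.dotDr A) γ) ∧
          (MeasureTheory.IntegrableOn (PlaneCalculus.div A) S ∧
            (∀ i, CurveIntegrable (PlaneCalculus.hodge (PlaneCalculus.dotDr A)) (γ i)) ∧
            ∫ p in S, PlaneCalculus.div A p
              = PlaneCalculus.boundaryIntegral
                  (PlaneCalculus.hodge (PlaneCalculus.dotDr A)) γ)) ∧
        (∀ f g : ℝ × ℝ → ℝ, ContDiffOn ℝ 1 f U → ContDiffOn ℝ 1 g U →
          MeasureTheory.IntegrableOn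
            (fun p => PlaneCalculus.partialX g p - PlaneCalculus.partialY f p) S ∧
          (∀ i, CurveIntegrable (PlaneCalculus.oneForm f g) (γ i)) ∧
          ∫ p in S, (PlaneCalculus.partialX g p - PlaneCalculus.partialY f p)
            = PlaneCalculus.boundaryIntegral (PlaneCalculus.oneForm f g) γ)) ∧
    -- the two gradient identities have the same integrand, up to sign
    (∀ f : ℝ × ℝ → ℝ,
      PlaneCalculus.dotDr (PlaneCalculus.grad f)
        = PlaneCalculus.oneForm (PlaneCalculus.partialX f) (PlaneCalculus.partialY f) ∧
      PlaneCalculus.hodge (PlaneCalculus.dotDr (PlaneCalculus.ham f))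
        = -PlaneCalculus.oneForm (PlaneCalculus.partialX f) (PlaneCalculus.partialY f)) ∧
    -- the curl identity for `(f, g)` and the divergence identity for `(g, -f)`
    -- both have the integrands of Green's theorem for `f dx + g dy`
    (∀ f g : ℝ × ℝ → ℝ,
      PlaneCalculus.curl3 (fun p => (f p, g p))
        = (fun p => PlaneCalculus.partialX g p - PlaneCalculus.partialY f p) ∧
      PlaneCalculus.dotDr (fun p => (f p, g p)) = PlaneCalculus.oneForm f g ∧
      PlaneCalculus.div (fun p => (g p, -f p))
        = (fun p => PlaneCalculus.partialX g p - PlaneCalculus.partialY f p) ∧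
      PlaneCalculus.hodge (PlaneCalculus.dotDr (fun p => (g p, -f p)))
        = PlaneCalculus.oneForm f g) := by
  open PlaneCalculus in
  refine ⟨?_, ?_, fun f => ⟨rfl, hodge_dotDr_ham f⟩, fun f g => ⟨rfl, rfl, div_neg_right f g, ?_⟩⟩
  · intro A B c hc U hU hcU f hf
    obtain ⟨hint, heq⟩ := gradient_theorem hc hU hcU hf
    refine ⟨⟨hint, heq⟩, ?_, hint, heq⟩
    rw [hodge_dotDr_ham]
    exact ⟨hint.neg, by rw [curveIntegral_neg, heq, neg_sub]⟩
  · intro S hS m P γ h U hU hSU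
    refine ⟨fun A hA => ?_, fun f g hf hg => h.green hS hU hSU hf hg⟩
    refine ⟨h.green hS hU hSU hA.fst hA.snd, ?_⟩
    -- The divergence identity is Green's theorem for `-A_y dx + A_x dy`.
    have := h.green hS hU hSU hA.snd.neg hA.fst
    rw [hodge_dotDr]
    have hdiv : PlaneCalculus.div A = fun p =>
        partialX (fun q => (A q).1) p - partialY (fun q => -(A q).2) p :=
      div_neg_right (fun q => -(A q).2) (fun q => (A q).1) ▸ by simp
    rw [hdiv]
    exact this
  · rw [hodge_dotDr]
    simp
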